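/- **Setting.** Let $S=\{p(x;t)\mid t\in\Theta\}$ be an $n$-dimensional statistical manifold: $\Theta\subset\mathbb R^n$ is open, $t\in\Theta$ serves as a global coordinate on $S$ (so $S$ is identified with $\Theta$ and its tangent spaces with $\mathbb R^n$), and $p(\cdot\,;t)>0$ are probability densities with respect to a measure $\mu$ on a sample space, smooth in $t$. Write $l=\log p$, $E[f]=\int f\,p(\cdot\,;t)\,d\mu$, $\partial_i=\partial/\partial t^i$. As regularity conditions we require that $(\partial_i l)(\partial_j l)$, $(\partial_i\partial_j l)(\partial_k l)$ and $(\partial_i l)(\partial_j l)(\partial_k l)$ have finite expectations depending smoothly on $t$, and that the Fisher matrix $g_{ij}=E[(\partial_i l)(\partial_j l)]$, whose associated metric is $\langle\cdot,\cdot\rangle$, is positive definite at each $t$. For $\alpha\in\mathbb R$ the $\alpha$-connection is defined by $$\langle\nabla^{(\alpha)}_AB,C\rangle=E[(ABl)(Cl)]+\tfrac{1-\alpha}{2}E[(Al)(Bl)(Cl)].$$ Let $\pi:F(S)\to S$ be the frame bundle, whose points are the linear isomorphisms $u:\mathbb R^n\to T_{\pi(u)}S$, with $GL(n,\mathbb R)$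 acting on the right by $ug=u\circ g$. Let $\{(U_\beta,x_\beta)\}_{\beta\in J}$ be any family of smooth coordinate charts covering $S$, put $e_i^\beta=\partial/\partial x_\beta^i$, and define $(\Gamma_\beta^{(\alpha)})_{ij}^k$ by $\nabla^{(\alpha)}_{e^\beta_i}e^\beta_j=(\Gamma_\beta^{(\alpha)})_{ij}^k\,e^\beta_k$. Let $(\omega_\beta^{(\alpha)})^k_j=(\Gamma_\beta^{(\alpha)})^k_{ji}\,dx^i_\beta$ be the $\alpha$-connection form on $U_\beta$. Let $\phi_\beta(u)\in GL(n,\mathbb R)$ be the matrix of $u$ in the basis $(e^\beta_i)$, and on $\pi^{-1}(U_\beta)$ put $$\widetilde\omega^{(\alpha)}_\beta=\mathrm{Ad}(\phi_\beta^{-1})\circ\pi^*\omega^{(\alpha)}_\beta+\phi_\beta^{-1}\,d\phi_\beta .$$ **Theorem.** The forms $\widetilde\omega^{(\alpha)}_\beta$ agree on overlaps and define a global smooth $gl(n,\mathbb R)$-valued 1-form $\widetilde\omega^{(\alpha)}$ on $F(S)$ which is a connection form, that is, $\widetilde\omega^{(\alpha)}_u(uA)=A$ for $A\in gl(n,\mathbb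 R)$ (where $uA$ is the velocity of $s\mapsto u\exp(sA)$ at $s=0$) and $R_g^*\widetilde\omega^{(\alpha)}=\mathrm{Ad}(g^{-1})\,\widetilde\omega^{(\alpha)}$ for $g\in GL(n,\mathbb R)$, with $R_g(u)=ug$. Let $H^{(\alpha)}=\ker\widetilde\omega^{(\alpha)}$, let $h^{(\alpha)}$ be the projection onto $H^{(\alpha)}$ along $\ker\pi_*$, and let $\widetilde X$ be the horizontal lift of a vector field $X$, i.e. the vector field with values in $H^{(\alpha)}$ and $\pi_*\widetilde X=X$. Let $\theta(W)=u^{-1}(\pi_*W)$, $W\in T_uF(S)$, be the canonical 1-form, and let $\Theta^{(\alpha)}=d\theta\circ h^{(\alpha)}$ and $\Omega^{(\alpha)}=d\widetilde\omega^{(\alpha)}\circ h^{(\alpha)}$ be the $\alpha$-torsion and $\alpha$-curvature forms, where $d\eta(V,W)=V(\eta(W))-W(\eta(V))-\eta([V,W])$ for a 1-form $\eta$. Then for all smooth vector fields $X,Y,Z$ on $S$ and every $u\in F(S)$, at the point $\pi(u)$: $$\nabla^{(\alpha)}_XY=u\big(\widetilde X_u(\theta(\widetilde Y))\big),$$ $$T^{(\alpha)}(X,Y):=u\big(\Theta^{(\alpha)}(\widetilde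 X_u,\widetilde Y_u)\big)=\nabla^{(\alpha)}_XY-\nabla^{(\alpha)}_YX-[X,Y],$$ $$R^{(\alpha)}(X,Y)Z:=u\big(\Omega^{(\alpha)}(\widetilde X_u,\widetilde Y_u)\,u^{-1}Z\big)=\nabla^{(\alpha)}_X\nabla^{(\alpha)}_YZ-\nabla^{(\alpha)}_Y\nabla^{(\alpha)}_XZ-\nabla^{(\alpha)}_{[X,Y]}Z .$$ In particular the middle expressions do not depend on the frame $u$ over the given point. -/

import Mathlib

open MeasureTheory
open scoped ContDiff

noncomputable section

/-! ### Statistical manifolds and their `α`-connections -/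

/-- `ℝⁿ`, with its standard topology. -/
abbrev Vec (n : ℕ) : Type := Fin n → ℝ

/-- `gl(n, ℝ)`, the linear endomorphisms of `ℝⁿ`. -/
abbrev Gl (n : ℕ) : Type := Vec n →L[ℝ] Vec n

/-- The function `A f`: derivative of `f` along the vector field `A`. -/
def along {n : ℕ} (A : Vec n → Vec n) (f : Vec n → ℝ) (t : Vec n) : ℝ :=
  fderiv ℝ f t (A t)

/-- The constant vector field `∂ᵢ` of the standard coordinates. -/
def coordField {n : ℕ} (i : Fin n) : Vec n → Vec n := fun _ => Pi.single i 1

/-- The expectation `E[f]` under the density `p(·; t)` with respect to `μ`. -/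
def expect {n : ℕ} {𝒳 : Type*} [MeasurableSpace 𝒳] (μ : Measure 𝒳) (p : 𝒳 → Vec n → ℝ)
    (t : Vec n) (f : 𝒳 → ℝ) : ℝ :=
  ∫ x, f x * p x t ∂μ

/-- An `n`-dimensional statistical manifold `S = {p(x; t) | t ∈ Θ}`, `Θ ⊆ ℝⁿ` open: the parameters
are global coordinates, and `S` is identified with `Θ` through them. The fields after `Θ` and `p`
are the regularity conditions that make the Fisher metric and the `α`-connections exist as smooth
objects. -/
structure StatisticalManifold (n : ℕ) (𝒳 : Type*) [MeasurableSpace 𝒳] where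
  /-- reference measure on the sample space -/
  μ : Measure 𝒳
  /-- parameter domain -/
  Θ : Set (Vec n)
  /-- the densities -/
  p : 𝒳 → Vec n → ℝ
  isOpen_Θ : IsOpen Θ
  pos : ∀ x, ∀ t ∈ Θ, 0 < p x t
  smooth : ∀ x, ContDiffOn ℝ ∞ (p x) Θ
  integrable : ∀ t ∈ Θ, Integrable (fun x => p x t) μ
  integral_eq_one : ∀ t ∈ Θ, ∫ x, p x t ∂μ = 1
  integrable_fisher : ∀ t ∈ Θ, ∀ i j : Fin n, Integrable (fun x =>
    along (coordField i) (fun s => Real.log (p x s)) t *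
    along (coordField j) (fun s => Real.log (p x s)) t * p x t) μ
  integrable_second : ∀ t ∈ Θ, ∀ i j k : Fin n, Integrable (fun x =>
    along (coordField i) (along (coordField j) (fun s => Real.log (p x s))) t *
    along (coordField k) (fun s => Real.log (p x s)) t * p x t) μ
  integrable_cubic : ∀ t ∈ Θ, ∀ i j k : Fin n, Integrable (fun x =>
    along (coordField i) (fun s => Real.log (p x s)) t *
    along (coordField j) (fun s => Real.log (p x s)) t *
    along (coordField k) (fun s => Real.log (p x s)) t * p x t) μ
  smooth_fisher : ∀ i j : Fin n, ContDiffOn ℝ ∞ (fun t => expect μ p t (fun x =>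
    along (coordField i) (fun s => Real.log (p x s)) t *
    along (coordField j) (fun s => Real.log (p x s)) t)) Θ
  smooth_second : ∀ i j k : Fin n, ContDiffOn ℝ ∞ (fun t => expect μ p t (fun x =>
    along (coordField i) (along (coordField j) (fun s => Real.log (p x s))) t *
    along (coordField k) (fun s => Real.log (p x s)) t)) Θ
  smooth_cubic : ∀ i j k : Fin n, ContDiffOn ℝ ∞ (fun t => expect μ p t (fun x =>
    along (coordField i) (fun s => Real.log (p x s)) t *
    along (coordField j) (fun s => Real.log (p x s)) t *
    along (coordField k) (fun s => Real.log (p x s)) t)) Θ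
  posDef_fisher : ∀ t ∈ Θ, (Matrix.of fun i j : Fin n => expect μ p t (fun x =>
    along (coordField i) (fun s => Real.log (p x s)) t *
    along (coordField j) (fun s => Real.log (p x s)) t)).PosDef

namespace StatisticalManifold

variable {n : ℕ} {𝒳 : Type*} [MeasurableSpace 𝒳] (S : StatisticalManifold n 𝒳)

/-- The log-likelihood `l(x; t) = log p(x; t)`. -/
def logLik (x : 𝒳) (t : Vec n) : ℝ := Real.log (S.p x t)

/-- The Fisher metric `⟨a, b⟩ = E[(a l)(b l)]` on the tangent space at `t`. -/
def fisher (t : Vec n) (a b : Vec n) : ℝ :=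
  expect S.μ S.p t fun x => fderiv ℝ (S.logLik x) t a * fderiv ℝ (S.logLik x) t b

/-- A smooth vector field on the statistical manifold. -/
def IsSmoothField (X : Vec n → Vec n) : Prop := ContDiffOn ℝ ∞ X S.Θ

/-- The `α`-connection: `∇_A B` at `t` is the tangent vector `w` with
`⟨w, c⟩ = E[(A B l)(c l)] + (1 - α)/2 E[(A l)(B l)(c l)]` for every tangent vector `c`
(it is unique because the Fisher metric is positive definite). -/
def nabla (α : ℝ) (A B : Vec n → Vec n) (t : Vec n) : Vec n :=
  Classical.epsilon fun w => ∀ c : Vec n, S.fisher t w c =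
    expect S.μ S.p t (fun x =>
      along A (along B (S.logLik x)) t * fderiv ℝ (S.logLik x) t c) +
    (1 - α) / 2 * expect S.μ S.p t (fun x =>
      along A (S.logLik x) t * along B (S.logLik x) t * fderiv ℝ (S.logLik x) t c)

/-- A family of coordinate charts `(U_β, x_β)` covering the statistical manifold. -/
structure Atlas (J : Type*) where
  /-- the charts; `U_β` is the source of `x_β` -/
  chart : J → OpenPartialHomeomorph (Vec n) (Vec n)
  source_subset : ∀ β, (chart β).source ⊆ S.Θ
  smooth : ∀ β, ContDiffOn ℝ ∞ (chart β) (chart β).source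
  smooth_symm : ∀ β, ContDiffOn ℝ ∞ (chart β).symm (chart β).target
  covers : ∀ t ∈ S.Θ, ∃ β, t ∈ (chart β).source

end StatisticalManifold

/-! ### The frame bundle -/

/-- The ambient space `ℝⁿ × gl(n, ℝ)` of the frame bundle; also its tangent space at each frame. -/
abbrev FrameSpace (n : ℕ) : Type := Vec n × Gl n

/-- The fundamental vector field `τ(A)_u = d/ds (u · exp (s A))` at `s = 0`. -/
def fundamentalField {n : ℕ} (A : Gl n) (u : FrameSpace n) : FrameSpace n := (0, u.2 * A)

/-- Right translation `R_g`, `R_g (t, a) = (t, a ∘ g)`. It is linear, so that this is also its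
differential. -/
def rightTranslation {n : ℕ} (g : Gl n) (u : FrameSpace n) : FrameSpace n := (u.1, u.2 * g)

/-- The canonical 1-form `θ_u(W) = u⁻¹(π_* W)` with values in `ℝⁿ`. -/
def canonicalForm {n : ℕ} (u : FrameSpace n) : FrameSpace n →L[ℝ] Vec n :=
  (Ring.inverse u.2).comp (ContinuousLinearMap.fst ℝ (Vec n) (Gl n))

/-- Exterior derivative of a 1-form, `dη(V, W) = V(η(W)) - W(η(V)) - η([V, W])`. -/
def extDerivOne {V F : Type*} [NormedAddCommGroup V] [NormedSpace ℝ V] [NormedAddCommGroup F]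
    [NormedSpace ℝ F] (η : V → V →L[ℝ] F) (u v w : V) : F :=
  extDeriv (fun y => ContinuousAlternatingMap.ofSubsingleton ℝ V F (0 : Fin 1) (η y)) u ![v, w]

/-- The vertical space `ker π_*` (the same subspace at every frame). -/
def verticalSpace (n : ℕ) : Submodule ℝ (FrameSpace n) :=
  LinearMap.ker (LinearMap.fst ℝ (Vec n) (Gl n))

/-- The horizontal space `H_u = ker conn_u` of a `gl(n, ℝ)`-valued 1-form `conn`. -/
def horizontalSpace {n : ℕ} (conn : FrameSpace n → FrameSpace n →L[ℝ] Gl n) (u : FrameSpace n) :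
    Submodule ℝ (FrameSpace n) :=
  LinearMap.ker (conn u : FrameSpace n →ₗ[ℝ] Gl n)

/-- The horizontal projection `h_u`: the `H_u`-part of a tangent vector in `H_u ⊕ V_u`. -/
def horizontalProj {n : ℕ} (conn : FrameSpace n → FrameSpace n →L[ℝ] Gl n)
    (u W : FrameSpace n) : FrameSpace n :=
  Classical.epsilon fun W' => W' ∈ horizontalSpace conn u ∧ W - W' ∈ verticalSpace n

/-- The horizontal lift of `X`: its value at `u` is the vector of `H_u` that `π_*` maps to
`X (π u)`. -/
def horizontalLift {n : ℕ} (conn : FrameSpace n → FrameSpace n →L[ℝ] Gl n) (X : Vec n → Vec n)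
    (u : FrameSpace n) : FrameSpace n :=
  Classical.epsilon fun W => W ∈ horizontalSpace conn u ∧ W.1 = X u.1

/-- The torsion form `dθ ∘ h` of the connection `ker conn`. -/
def torsionForm {n : ℕ} (conn : FrameSpace n → FrameSpace n →L[ℝ] Gl n)
    (u V W : FrameSpace n) : Vec n :=
  extDerivOne canonicalForm u (horizontalProj conn u V) (horizontalProj conn u W)

/-- The curvature form `d conn ∘ h` of the connection `ker conn`. -/
def curvatureForm {n : ℕ} (conn : FrameSpace n → FrameSpace n →L[ℝ] Gl n)
    (u V W : FrameSpace n) : Gl n :=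
  extDerivOne conn u (horizontalProj conn u V) (horizontalProj conn u W)

/-- The endomorphism of `ℝⁿ` with a given matrix. -/
def matrixToGl {n : ℕ} (M : Matrix (Fin n) (Fin n) ℝ) : Gl n :=
  LinearMap.toContinuousLinearMap (Matrix.toLin' M)

/-- The frame field: `e_i = ∂/∂x^i` for a chart `x`. -/
def chartField {n : ℕ} (x : OpenPartialHomeomorph (Vec n) (Vec n)) (i : Fin n) :
    Vec n → Vec n :=
  fun t => fderiv ℝ x.symm (x t) (Pi.single i 1)

/-- The dual coframe: `dx^i` for a chart `x`. -/
def chartCoframe {n : ℕ} (x : OpenPartialHomeomorph (Vec n) (Vec n)) (i : Fin n)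
    (t : Vec n) : Vec n →L[ℝ] ℝ :=
  (ContinuousLinearMap.proj i).comp (fderiv ℝ x t)

/-- The fibre component `φ(u)` of the local trivialization `u ↦ (π u, φ(u))` of the frame bundle
given by a chart `x`: the matrix of the frame `u` in the basis `(e_i)`. -/
def trivialization {n : ℕ} (x : OpenPartialHomeomorph (Vec n) (Vec n)) (u : FrameSpace n) :
    Gl n :=
  (fderiv ℝ x u.1).comp u.2

/-- `Ad(g⁻¹) B = g⁻¹ B g`. -/
def adInv {n : ℕ} (g : Gl n) : Gl n →L[ℝ] Gl n :=
  ContinuousLinearMap.mulLeftRight ℝ (Gl n) (Ring.inverse g) g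

/-- The canonical 1-form of the group `GL(n, ℝ)` at `g`, `B ↦ g⁻¹ B`. -/
def maurerCartan {n : ℕ} (g : Gl n) : Gl n →L[ℝ] Gl n :=
  ContinuousLinearMap.mul ℝ (Gl n) (Ring.inverse g)

namespace StatisticalManifold

variable {n : ℕ} {𝒳 : Type*} [MeasurableSpace 𝒳] (S : StatisticalManifold n 𝒳)

/-- The frame bundle `F(S)`: pairs `(t, a)` of a point and a linear isomorphism `a` from `ℝⁿ` to
the tangent space at `t`; an open subset of `ℝⁿ × gl(n, ℝ)`. The projection `π` is `Prod.fst`. -/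
def frameBundle : Set (FrameSpace n) := {u | u.1 ∈ S.Θ ∧ IsUnit u.2}

/-- The connection coefficients `Γ_{ij}^k` of `∇^(α)` in a chart: `∇_{e_i} e_j = Γ_{ij}^k e_k`. -/
def christoffel (α : ℝ) (x : OpenPartialHomeomorph (Vec n) (Vec n)) (i j k : Fin n)
    (t : Vec n) : ℝ :=
  chartCoframe x k t (S.nabla α (chartField x i) (chartField x j) t)

/-- The `α`-connection form of a chart, `ω_j^k = Γ_{ji}^k dx^i` (row `k`, column `j`). -/
def alphaForm (α : ℝ) (x : OpenPartialHomeomorph (Vec n) (Vec n)) (t : Vec n) :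
    Vec n →L[ℝ] Gl n :=
  ∑ i, (chartCoframe x i t).smulRight (matrixToGl (Matrix.of fun k j => S.christoffel α x j i k t))

/-- The local form `Ad(φ⁻¹) ∘ π^* ω + φ^* θ_GL` over the domain of a chart `x`. -/
def localAlphaForm (α : ℝ) (x : OpenPartialHomeomorph (Vec n) (Vec n)) (u : FrameSpace n) :
    FrameSpace n →L[ℝ] Gl n :=
  (adInv (trivialization x u)).comp
      ((S.alphaForm α x u.1).comp (ContinuousLinearMap.fst ℝ (Vec n) (Gl n))) +
    (maurerCartan (trivialization x u)).comp (fderiv ℝ (trivialization x) u)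

open Classical in
/-- The global form on the frame bundle obtained from the local ones: at `u` it is the local form
of some chart around `π u`. -/
def alphaConnectionForm {J : Type*} (𝒜 : S.Atlas J) (α : ℝ) (u : FrameSpace n) :
    FrameSpace n →L[ℝ] Gl n :=
  if h : ∃ β, u.1 ∈ (𝒜.chart β).source then S.localAlphaForm α (𝒜.chart h.choose) u else 0

/-- `conn` is (the form of) a connection on the principal `GL(n, ℝ)`-bundle `F(S)`. -/
structure IsConnectionForm (conn : FrameSpace n → FrameSpace n →L[ℝ] Gl n) : Prop where
  smooth : ContDiffOn ℝ ∞ conn S.frameBundle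
  fundamental : ∀ u ∈ S.frameBundle, ∀ A : Gl n, conn u (fundamentalField A u) = A
  equivariant : ∀ u ∈ S.frameBundle, ∀ g : Gl n, IsUnit g → ∀ W : FrameSpace n,
    conn (rightTranslation g u) (rightTranslation g W) = adInv g (conn u W)

end StatisticalManifold

end

/-! The global coordinates `t` make `F(S)` an open subset of `ℝⁿ × gl(n)`, and over `Θ` the
connection takes the form `∇_A B = DB(A) + C(A)B`. Here `C` is `difference`: the inverse Fisher
operator applied to `E[(∂ᵢ∂ⱼl)(∂ₖl)] + (1-α)/2 · E[(∂ᵢl)(∂ⱼl)(∂ₖl)]`, so it is smooth, and it is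
symmetric because second derivatives commute (`nabla_eq`, `difference_symm`,
`contDiffAt_difference`).

Let `x` be a chart. Passing to its frame replaces `C` by its conjugate under `Dx` minus a Hessian
term in `D²x`. The matrix of a frame `a` is `φ = Dx · a`, and `φ⁻¹dφ` contributes the same Hessian
term with the opposite sign. Hence every local form equals `a⁻¹(C a + da)`, which is `frameForm` and
does not mention `x` (`localAlphaForm_eq`). Gluing, smoothness and the two connection axioms are
then read off this formula.

A horizontal vector at `(t, a)` has the form `(v, -C(v)a)`. Differentiating `a⁻¹Y` along it gives
`a⁻¹(DY(X) + C(X)Y)`; `dθ` gives `C(X)Y - C(Y)X`; the derivative of the connection form gives `dC +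
C ∧ C`. These match the classical expressions in `∇` once the same formula for `∇` is expanded there
(`torsionForm_horizontal`, `curvatureForm_horizontal`, `curvature_nabla`). -/

namespace ContinuousLinearMap

theorem apply_eq_sum_single {n : ℕ} {F : Type*} [NormedAddCommGroup F] [NormedSpace ℝ F]
    (f : Vec n →L[ℝ] F) (a : Vec n) : f a = ∑ i, a i • f (Pi.single i 1) := by
  conv_lhs => rw [pi_eq_sum_univ' a]
  simp

end ContinuousLinearMap

theorem contDiff_mul_clm {R : Type*} [NormedRing R] [NormedAlgebra ℝ R] :
    ContDiff ℝ ∞ fun a : R => ContinuousLinearMap.mul ℝ R a :=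
  (ContinuousLinearMap.mul ℝ R).contDiff

theorem contDiff_mul_flip_clm {R : Type*} [NormedRing R] [NormedAlgebra ℝ R] :
    ContDiff ℝ ∞ fun a : R => (ContinuousLinearMap.mul ℝ R).flip a :=
  (ContinuousLinearMap.mul ℝ R).flip.contDiff

theorem ContDiffAt.isSymmSndFDerivAt_of_smooth {E F : Type*} [NormedAddCommGroup E]
    [NormedSpace ℝ E] [NormedAddCommGroup F] [NormedSpace ℝ F] {f : E → F} {x : E}
    (hf : ContDiffAt ℝ ∞ f x) : IsSymmSndFDerivAt ℝ f x := by
  refine hf.isSymmSndFDerivAt ?_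
  rw [minSmoothness_of_isRCLikeNormedField]
  exact WithTop.coe_le_coe.2 (le_top : (2 : ℕ∞) ≤ ⊤)

theorem ContDiffAt.differentiableAt_fderiv {E F : Type*} [NormedAddCommGroup E]
    [NormedSpace ℝ E] [NormedAddCommGroup F] [NormedSpace ℝ F] {f : E → F} {x : E}
    (hf : ContDiffAt ℝ ∞ f x) : DifferentiableAt ℝ (fderiv ℝ f) x :=
  (hf.fderiv_right (m := 1) (by norm_cast)).differentiableAt one_ne_zero

/-! ### The `α`-connection in the global coordinates. -/

namespace StatisticalManifold

variable {n : ℕ} {𝒳 : Type*} [MeasurableSpace 𝒳] (S : StatisticalManifold n 𝒳)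

/-- The Hessian `D²l` of the log-likelihood. -/
noncomputable def hessLogLik (x : 𝒳) (t : Vec n) : Vec n →L[ℝ] Vec n →L[ℝ] ℝ :=
  fderiv ℝ (fderiv ℝ (S.logLik x)) t

theorem contDiffAt_logLik (x : 𝒳) {t : Vec n} (ht : t ∈ S.Θ) :
    ContDiffAt ℝ ∞ (S.logLik x) t :=
  ((S.smooth x).contDiffAt (S.isOpen_Θ.mem_nhds ht)).log (S.pos x t ht).ne'

theorem differentiableAt_fderiv_logLik (x : 𝒳) {t : Vec n} (ht : t ∈ S.Θ) :
    DifferentiableAt ℝ (fderiv ℝ (S.logLik x)) t :=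
  (S.contDiffAt_logLik x ht).differentiableAt_fderiv

theorem hessLogLik_symm (x : 𝒳) {t : Vec n} (ht : t ∈ S.Θ) (a b : Vec n) :
    S.hessLogLik x t a b = S.hessLogLik x t b a :=
  ((S.contDiffAt_logLik x ht).isSymmSndFDerivAt_of_smooth).eq a b

/-- Product rule. The Hessian part is tensorial in `A` and `B` and feeds the difference tensor;
paired with `c l`, the other part becomes the Fisher product of `DB(A)` with `c`. -/
theorem along_along_logLik (x : 𝒳) {t : Vec n} (ht : t ∈ S.Θ) (A B : Vec n → Vec n)
    (hB : DifferentiableAt ℝ B t) :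
    along A (along B (S.logLik x)) t =
      S.hessLogLik x t (A t) (B t) + fderiv ℝ (S.logLik x) t (fderiv ℝ B t (A t)) := by
  unfold along hessLogLik
  rw [fderiv_clm_apply (S.differentiableAt_fderiv_logLik x ht) hB]
  simp [add_comm]

theorem along_along_coordField_logLik (x : 𝒳) {t : Vec n} (ht : t ∈ S.Θ) (i j : Fin n) :
    along (coordField i) (along (coordField j) (S.logLik x)) t =
      S.hessLogLik x t (Pi.single i 1) (Pi.single j 1) := by
  have h (k : Fin n) : (coordField k : Vec n → Vec n) = fun _ => Pi.single k 1 := rfl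
  rw [S.along_along_logLik x ht _ _ (h j ▸ differentiableAt_const _)]
  simp [h]

theorem hessLogLik_eq_sum (x : 𝒳) {t : Vec n} (ht : t ∈ S.Θ) (a b : Vec n) :
    S.hessLogLik x t a b = ∑ i, ∑ j, a i * b j *
      along (coordField i) (along (coordField j) (S.logLik x)) t := by
  rw [ContinuousLinearMap.apply_eq_sum_single (S.hessLogLik x t), sum_apply]
  refine Finset.sum_congr rfl fun i _ => ?_
  rw [smul_apply, ContinuousLinearMap.apply_eq_sum_single, Finset.smul_sum]
  refine Finset.sum_congr rfl fun j _ => ?_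
  rw [S.along_along_coordField_logLik x ht, smul_eq_mul, smul_eq_mul, mul_assoc]

theorem fderiv_logLik_eq_sum (x : 𝒳) (t a : Vec n) :
    fderiv ℝ (S.logLik x) t a = ∑ i, a i * along (coordField i) (S.logLik x) t := by
  rw [ContinuousLinearMap.apply_eq_sum_single]
  rfl

/-- The coefficients `g_{ij}` of the Fisher metric. -/
noncomputable def fisherCoeff (t : Vec n) (i j : Fin n) : ℝ :=
  expect S.μ S.p t fun x =>
    along (coordField i) (S.logLik x) t * along (coordField j) (S.logLik x) t

/-- The coefficients `E[(∂ᵢ ∂ⱼ l)(∂ₖ l)]`. -/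
noncomputable def secondCoeff (t : Vec n) (i j k : Fin n) : ℝ :=
  expect S.μ S.p t fun x =>
    along (coordField i) (along (coordField j) (S.logLik x)) t *
      along (coordField k) (S.logLik x) t

/-- The coefficients `E[(∂ᵢ l)(∂ⱼ l)(∂ₖ l)]`. -/
noncomputable def cubicCoeff (t : Vec n) (i j k : Fin n) : ℝ :=
  expect S.μ S.p t fun x =>
    along (coordField i) (S.logLik x) t * along (coordField j) (S.logLik x) t *
      along (coordField k) (S.logLik x) t

/-- Integrability is assumed only for coordinate fields; this multilinear expansion and its two
analogues extend it to arbitrary tangent vectors. -/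
theorem fisher_integrand_eq_sum (x : 𝒳) (t a b : Vec n) :
    fderiv ℝ (S.logLik x) t a * fderiv ℝ (S.logLik x) t b * S.p x t =
      ∑ i, ∑ j, a i * b j * (along (coordField i) (S.logLik x) t *
        along (coordField j) (S.logLik x) t * S.p x t) := by
  rw [S.fderiv_logLik_eq_sum x t a, S.fderiv_logLik_eq_sum x t b, Finset.sum_mul_sum,
    Finset.sum_mul]
  refine Finset.sum_congr rfl fun i _ => ?_
  rw [Finset.sum_mul]
  exact Finset.sum_congr rfl fun j _ => by ring

theorem second_integrand_eq_sum (x : 𝒳) {t : Vec n} (ht : t ∈ S.Θ) (a b c : Vec n) :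
    S.hessLogLik x t a b * fderiv ℝ (S.logLik x) t c * S.p x t =
      ∑ i, ∑ j, ∑ k, a i * b j * c k *
        (along (coordField i) (along (coordField j) (S.logLik x)) t *
          along (coordField k) (S.logLik x) t * S.p x t) := by
  rw [S.hessLogLik_eq_sum x ht a b, S.fderiv_logLik_eq_sum x t c]
  simp only [Finset.sum_mul]
  refine Finset.sum_congr rfl fun i _ => Finset.sum_congr rfl fun j _ => ?_
  rw [Finset.mul_sum, Finset.sum_mul]
  exact Finset.sum_congr rfl fun k _ => by ring

theorem cubic_integrand_eq_sum (x : 𝒳) (t a b c : Vec n) :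
    fderiv ℝ (S.logLik x) t a * fderiv ℝ (S.logLik x) t b * fderiv ℝ (S.logLik x) t c *
        S.p x t =
      ∑ i, ∑ j, ∑ k, a i * b j * c k *
        (along (coordField i) (S.logLik x) t * along (coordField j) (S.logLik x) t *
          along (coordField k) (S.logLik x) t * S.p x t) := by
  rw [S.fderiv_logLik_eq_sum x t a, S.fderiv_logLik_eq_sum x t b, Finset.sum_mul_sum,
    S.fderiv_logLik_eq_sum x t c]
  simp only [Finset.sum_mul]
  refine Finset.sum_congr rfl fun i _ => Finset.sum_congr rfl fun j _ => ?_
  rw [Finset.mul_sum, Finset.sum_mul]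
  exact Finset.sum_congr rfl fun k _ => by ring

theorem integrable_fisher_apply {t : Vec n} (ht : t ∈ S.Θ) (a b : Vec n) :
    Integrable (fun x => fderiv ℝ (S.logLik x) t a * fderiv ℝ (S.logLik x) t b * S.p x t)
      S.μ := by
  simp only [S.fisher_integrand_eq_sum]
  exact integrable_finsetSum _ fun i _ => integrable_finsetSum _ fun j _ =>
    (S.integrable_fisher t ht i j).const_mul _

theorem integrable_second_apply {t : Vec n} (ht : t ∈ S.Θ) (a b c : Vec n) :
    Integrable (fun x => S.hessLogLik x t a b * fderiv ℝ (S.logLik x) t c * S.p x t) S.μ := by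
  simp only [S.second_integrand_eq_sum _ ht]
  exact integrable_finsetSum _ fun i _ => integrable_finsetSum _ fun j _ =>
    integrable_finsetSum _ fun k _ => (S.integrable_second t ht i j k).const_mul _

theorem fisher_eq_sum {t : Vec n} (ht : t ∈ S.Θ) (a b : Vec n) :
    S.fisher t a b = ∑ i, ∑ j, a i * b j * S.fisherCoeff t i j := by
  have h i j : Integrable (fun x => a i * b j * (along (coordField i) (S.logLik x) t *
      along (coordField j) (S.logLik x) t * S.p x t)) S.μ :=
    (S.integrable_fisher t ht i j).const_mul _
  unfold fisher fisherCoeff expect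
  simp only [S.fisher_integrand_eq_sum]
  rw [integral_finsetSum _ fun i _ => integrable_finsetSum _ fun j _ => h i j]
  refine Finset.sum_congr rfl fun i _ => ?_
  rw [integral_finsetSum _ fun j _ => h i j]
  exact Finset.sum_congr rfl fun j _ => integral_const_mul _ _

theorem expect_second_eq_sum {t : Vec n} (ht : t ∈ S.Θ) (a b c : Vec n) :
    expect S.μ S.p t (fun x => S.hessLogLik x t a b * fderiv ℝ (S.logLik x) t c) =
      ∑ i, ∑ j, ∑ k, a i * b j * c k * S.secondCoeff t i j k := by
  have h i j k : Integrable (fun x => a i * b j * c k *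
      (along (coordField i) (along (coordField j) (S.logLik x)) t *
        along (coordField k) (S.logLik x) t * S.p x t)) S.μ :=
    (S.integrable_second t ht i j k).const_mul _
  unfold secondCoeff expect
  simp only [S.second_integrand_eq_sum _ ht]
  rw [integral_finsetSum _ fun i _ => integrable_finsetSum _ fun j _ =>
    integrable_finsetSum _ fun k _ => h i j k]
  refine Finset.sum_congr rfl fun i _ => ?_
  rw [integral_finsetSum _ fun j _ => integrable_finsetSum _ fun k _ => h i j k]
  refine Finset.sum_congr rfl fun j _ => ?_
  rw [integral_finsetSum _ fun k _ => h i j k]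
  exact Finset.sum_congr rfl fun k _ => integral_const_mul _ _

theorem expect_cubic_eq_sum {t : Vec n} (ht : t ∈ S.Θ) (a b c : Vec n) :
    expect S.μ S.p t (fun x => fderiv ℝ (S.logLik x) t a * fderiv ℝ (S.logLik x) t b *
        fderiv ℝ (S.logLik x) t c) =
      ∑ i, ∑ j, ∑ k, a i * b j * c k * S.cubicCoeff t i j k := by
  have h i j k : Integrable (fun x => a i * b j * c k * (along (coordField i) (S.logLik x) t *
      along (coordField j) (S.logLik x) t * along (coordField k) (S.logLik x) t * S.p x t))
      S.μ :=
    (S.integrable_cubic t ht i j k).const_mul _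
  unfold cubicCoeff expect
  simp only [S.cubic_integrand_eq_sum]
  rw [integral_finsetSum _ fun i _ => integrable_finsetSum _ fun j _ =>
    integrable_finsetSum _ fun k _ => h i j k]
  refine Finset.sum_congr rfl fun i _ => ?_
  rw [integral_finsetSum _ fun j _ => integrable_finsetSum _ fun k _ => h i j k]
  refine Finset.sum_congr rfl fun j _ => ?_
  rw [integral_finsetSum _ fun k _ => h i j k]
  exact Finset.sum_congr rfl fun k _ => integral_const_mul _ _

/-- The Christoffel symbols of the first kind of the `α`-connection in the global coordinates. -/
noncomputable def lowerChristoffel (α : ℝ) (t : Vec n) (i j k : Fin n) : ℝ :=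
  S.secondCoeff t i j k + (1 - α) / 2 * S.cubicCoeff t i j k

theorem lowerChristoffel_symm (α : ℝ) {t : Vec n} (ht : t ∈ S.Θ) (i j k : Fin n) :
    S.lowerChristoffel α t i j k = S.lowerChristoffel α t j i k := by
  simp only [lowerChristoffel, secondCoeff, cubicCoeff, S.along_along_coordField_logLik _ ht]
  congr 2
  · exact funext fun x => by rw [S.hessLogLik_symm x ht]
  · exact congrArg _ (funext fun x => by ring)

/-- The Fisher matrix as an endomorphism of `ℝⁿ`. -/
noncomputable def fisherOperator (t : Vec n) : Gl n :=
  matrixToGl (Matrix.of fun i j => S.fisherCoeff t i j)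

theorem fisherOperator_apply (t a : Vec n) (i : Fin n) :
    S.fisherOperator t a i = ∑ j, S.fisherCoeff t i j * a j := by
  simp [fisherOperator, matrixToGl, Matrix.mulVec, dotProduct]

theorem fisherCoeff_symm (t : Vec n) (i j : Fin n) :
    S.fisherCoeff t i j = S.fisherCoeff t j i := by
  simp only [fisherCoeff, mul_comm]

theorem fisher_eq_fisherOperator {t : Vec n} (ht : t ∈ S.Θ) (a b : Vec n) :
    S.fisher t a b = ∑ k, b k * S.fisherOperator t a k := by
  rw [S.fisher_eq_sum ht, Finset.sum_comm]
  refine Finset.sum_congr rfl fun k _ => ?_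
  rw [fisherOperator_apply, Finset.mul_sum]
  refine Finset.sum_congr rfl fun i _ => ?_
  rw [S.fisherCoeff_symm t i k]
  ring

theorem isUnit_fisherOperator {t : Vec n} (ht : t ∈ S.Θ) : IsUnit (S.fisherOperator t) := by
  obtain ⟨⟨M, N, hMN, hNM⟩, rfl : M = _⟩ := (S.posDef_fisher t ht).isUnit
  have key (P Q : Matrix (Fin n) (Fin n) ℝ) (h : P * Q = 1) :
      matrixToGl P * matrixToGl Q = 1 := by
    ext1 v
    simp [matrixToGl, h]
  exact ⟨⟨_, matrixToGl N, key _ _ hMN, key _ _ hNM⟩, rfl⟩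

/-- The lowered difference `a ↦ (b ↦ ⟨C(a) b, ·⟩)` between the `α`-connection and the flat
connection of the global coordinates. -/
noncomputable def lowerDifference (α : ℝ) (t : Vec n) : Vec n →L[ℝ] Gl n :=
  ∑ i, ∑ j, ∑ k, S.lowerChristoffel α t i j k •
    (ContinuousLinearMap.proj (R := ℝ) (φ := fun _ : Fin n => ℝ) i).smulRight
      ((ContinuousLinearMap.proj (R := ℝ) (φ := fun _ : Fin n => ℝ) j).smulRight
        (Pi.single k 1 : Vec n))

theorem lowerDifference_apply (α : ℝ) (t a b : Vec n) (k : Fin n) :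
    S.lowerDifference α t a b k = ∑ i, ∑ j, a i * b j * S.lowerChristoffel α t i j k := by
  simp only [lowerDifference, sum_apply, Finset.sum_apply]
  refine Finset.sum_congr rfl fun i _ => Finset.sum_congr rfl fun j _ => ?_
  simp [Pi.single_apply]
  ring

/-- The difference tensor between the `α`-connection and the flat connection of the global
coordinates. -/
noncomputable def difference (α : ℝ) (t : Vec n) : Vec n →L[ℝ] Gl n :=
  (ContinuousLinearMap.mul ℝ (Gl n) (Ring.inverse (S.fisherOperator t))).comp
    (S.lowerDifference α t)

theorem difference_apply (α : ℝ) (t a b : Vec n) :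
    S.difference α t a b = Ring.inverse (S.fisherOperator t) (S.lowerDifference α t a b) := rfl

theorem difference_symm (α : ℝ) {t : Vec n} (ht : t ∈ S.Θ) (a b : Vec n) :
    S.difference α t a b = S.difference α t b a := by
  rw [difference_apply, difference_apply]
  congr 1
  ext k
  rw [lowerDifference_apply, lowerDifference_apply, Finset.sum_comm]
  refine Finset.sum_congr rfl fun i _ => Finset.sum_congr rfl fun j _ => ?_
  rw [S.lowerChristoffel_symm α ht j i]
  ring

theorem contDiffAt_fisherOperator {t : Vec n} (ht : t ∈ S.Θ) :
    ContDiffAt ℝ ∞ S.fisherOperator t := by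
  let f : (Fin n → Fin n → ℝ) →ₗ[ℝ] Gl n :=
    { toFun := fun M => matrixToGl (Matrix.of M)
      map_add' := fun M N => by simp [matrixToGl, ← Matrix.of_add_of]
      map_smul' := fun c M => by simp [matrixToGl, ← Matrix.smul_of] }
  refine f.toContinuousLinearMap.contDiff.contDiffAt.comp t (contDiffAt_pi.2 fun i =>
    contDiffAt_pi.2 fun j => ?_)
  exact (S.smooth_fisher i j).contDiffAt (S.isOpen_Θ.mem_nhds ht)

theorem contDiffAt_difference (α : ℝ) {t : Vec n} (ht : t ∈ S.Θ) :
    ContDiffAt ℝ ∞ (S.difference α) t := by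
  have hF : ContDiffAt ℝ ∞ (fun s => Ring.inverse (S.fisherOperator s)) t := by
    obtain ⟨F, hF⟩ := S.isUnit_fisherOperator ht
    have hinv : ContDiffAt ℝ ∞ Ring.inverse (S.fisherOperator t) :=
      hF ▸ contDiffAt_ringInverse ℝ F
    exact hinv.comp t (S.contDiffAt_fisherOperator ht)
  refine (contDiff_mul_clm.contDiffAt.comp t hF).clm_comp ?_
  unfold lowerDifference lowerChristoffel
  refine ContDiffAt.sum fun i _ => ContDiffAt.sum fun j _ => ContDiffAt.sum fun k _ =>
    ContDiffAt.fun_smul (ContDiffAt.add ?_ (contDiffAt_const.mul ?_)) contDiffAt_const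
  · exact (S.smooth_second i j k).contDiffAt (S.isOpen_Θ.mem_nhds ht)
  · exact (S.smooth_cubic i j k).contDiffAt (S.isOpen_Θ.mem_nhds ht)

/-- Since `nabla` is a choice, two facts are needed: the right-hand side satisfies the defining
property (`hrhs`), and invertibility of the Fisher operator makes the solution unique. -/
theorem nabla_eq (α : ℝ) {t : Vec n} (ht : t ∈ S.Θ) (A B : Vec n → Vec n)
    (hB : DifferentiableAt ℝ B t) :
    S.nabla α A B t = fderiv ℝ B t (A t) + S.difference α t (A t) (B t) := by
  have hunit := S.isUnit_fisherOperator ht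
  have hcomm (f : Fin n → Fin n → Fin n → ℝ) :
      ∑ i, ∑ j, ∑ k, f i j k = ∑ k, ∑ i, ∑ j, f i j k := by
    rw [Finset.sum_comm (f := fun k i => ∑ j, f i j k)]
    exact Finset.sum_congr rfl fun i _ => Finset.sum_comm
  have hrhs (c : Vec n) : expect S.μ S.p t (fun x =>
        along A (along B (S.logLik x)) t * fderiv ℝ (S.logLik x) t c) +
      (1 - α) / 2 * expect S.μ S.p t (fun x =>
        along A (S.logLik x) t * along B (S.logLik x) t * fderiv ℝ (S.logLik x) t c) =
      S.fisher t (fderiv ℝ B t (A t) + S.difference α t (A t) (B t)) c := by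
    have h1 : expect S.μ S.p t (fun x =>
        along A (along B (S.logLik x)) t * fderiv ℝ (S.logLik x) t c) =
        expect S.μ S.p t (fun x => S.hessLogLik x t (A t) (B t) * fderiv ℝ (S.logLik x) t c) +
          S.fisher t (fderiv ℝ B t (A t)) c := by
      unfold fisher expect
      rw [← integral_add (S.integrable_second_apply ht _ _ _) (S.integrable_fisher_apply ht _ _)]
      refine integral_congr_ae (.of_forall fun x => ?_)
      simp only [S.along_along_logLik x ht A B hB]
      ring
    have h2 : S.fisherOperator t (S.difference α t (A t) (B t)) =
        S.lowerDifference α t (A t) (B t) :=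
      congrArg (fun f : Gl n => f _) (Ring.mul_inverse_cancel _ hunit)
    rw [h1, S.expect_second_eq_sum ht,
      show expect S.μ S.p t (fun x => along A (S.logLik x) t * along B (S.logLik x) t *
        fderiv ℝ (S.logLik x) t c) = _ from S.expect_cubic_eq_sum ht (A t) (B t) c,
      S.fisher_eq_fisherOperator ht, S.fisher_eq_fisherOperator ht, map_add, h2]
    simp only [Pi.add_apply, mul_add, Finset.sum_add_distrib]
    rw [add_comm (∑ i, ∑ j, ∑ k, _), add_assoc]
    congr 1
    simp only [lowerDifference_apply, Finset.mul_sum, lowerChristoffel, mul_add,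
      Finset.sum_add_distrib]
    congr 1
    · rw [hcomm]
      refine Finset.sum_congr rfl fun k _ => Finset.sum_congr rfl fun i _ =>
        Finset.sum_congr rfl fun j _ => by ring
    · rw [hcomm]
      refine Finset.sum_congr rfl fun k _ => Finset.sum_congr rfl fun i _ =>
        Finset.sum_congr rfl fun j _ => by ring
  have hspec := Classical.epsilon_spec (p := fun w => ∀ c : Vec n, S.fisher t w c =
    expect S.μ S.p t (fun x =>
      along A (along B (S.logLik x)) t * fderiv ℝ (S.logLik x) t c) +
    (1 - α) / 2 * expect S.μ S.p t (fun x =>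
      along A (S.logLik x) t * along B (S.logLik x) t * fderiv ℝ (S.logLik x) t c))
    ⟨_, fun c => (hrhs c).symm⟩
  have hinj : Function.Injective (S.fisherOperator t) := by
    obtain ⟨F, hF⟩ := hunit
    rw [← hF]
    exact Function.LeftInverse.injective (g := (↑F⁻¹ : Gl n)) fun v =>
      congrArg (fun f : Gl n => f v) F.inv_mul
  -- Testing the two solutions against `c = Pi.single k 1` extracts the `k`-th coordinate of their
  -- images under the Fisher operator.
  refine hinj (funext fun k => ?_)
  have := (hspec (Pi.single k 1)).trans (hrhs _)
  rw [S.fisher_eq_fisherOperator ht, S.fisher_eq_fisherOperator ht] at this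
  simpa only [nabla, Pi.single_apply, ite_mul, one_mul, zero_mul, Finset.sum_ite_eq',
    Finset.mem_univ, if_true] using this

end StatisticalManifold
/-! ### Connections on the frame bundle given by a difference tensor -/

theorem contDiffAt_ringInverse_of_isUnit {R : Type*} [NormedRing R] [NormedAlgebra ℝ R]
    [CompleteSpace R] {a : R} (ha : IsUnit a) : ContDiffAt ℝ ∞ (Ring.inverse : R → R) a := by
  obtain ⟨x, rfl⟩ := ha
  exact contDiffAt_ringInverse ℝ x

theorem hasFDerivAt_ringInverse_of_isUnit {R : Type*} [NormedRing R] [NormedAlgebra ℝ R]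
    [CompleteSpace R] {a : R} (ha : IsUnit a) :
    HasFDerivAt (Ring.inverse : R → R)
      (-ContinuousLinearMap.mulLeftRight ℝ R (Ring.inverse a) (Ring.inverse a)) a := by
  obtain ⟨x, rfl⟩ := ha
  simpa using hasFDerivAt_ringInverse (𝕜 := ℝ) x

/-- The second factor vanishes at `u`, so the derivative of `a` drops out. With `a` the inverse
frame, this spares differentiating the inverse on horizontal vectors. -/
theorem fderiv_mul_mul_add_const_apply {E R : Type*} [NormedAddCommGroup E] [NormedSpace ℝ E]
    [NormedRing R] [NormedAlgebra ℝ R] {a b c : E → R} {a' b' c' : E →L[ℝ] R} {d : R} {u : E}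
    (ha : HasFDerivAt a a' u) (hb : HasFDerivAt b b' u) (hc : HasFDerivAt c c' u)
    (hd : b u * c u + d = 0) (v : E) :
    fderiv ℝ (fun x => a x * (b x * c x + d)) u v = a u * (b' v * c u + b u * c' v) := by
  have h : HasFDerivAt (fun x => a x * (b x * c x + d)) _ u :=
    ha.mul' ((hb.mul' hc).add_const d)
  rw [h.fderiv]
  simp [hd, add_comm, mul_add]

/-- The vectors `v`, `w` are extended as constant fields, which commute; hence no bracket term. -/
theorem extDerivOne_apply {V F : Type*} [NormedAddCommGroup V] [NormedSpace ℝ V]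
    [NormedAddCommGroup F] [NormedSpace ℝ F] {η : V → V →L[ℝ] F} {u : V}
    (hη : DifferentiableAt ℝ η u) (v w : V) :
    extDerivOne η u v w = fderiv ℝ (fun y => η y w) u v - fderiv ℝ (fun y => η y v) u w := by
  have h : DifferentiableAt ℝ
      (fun y => ContinuousAlternatingMap.ofSubsingleton ℝ V F (0 : Fin 1) (η y)) u :=
    (ContinuousAlternatingMap.ofSubsingletonLIE (𝕜 := ℝ) (E := V) (F := F)
      (0 : Fin 1)).differentiable.differentiableAt.comp u hη
  unfold extDerivOne
  rw [extDeriv_apply h]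
  simp [Fin.sum_univ_two, Fin.removeNth, sub_eq_add_neg]

section

variable {n : ℕ}

/-- The 1-form `u⁻¹ (C u + du)` on the frame bundle: the connection form of the linear connection
`∇_A B = DB(A) + C(A) B`. -/
noncomputable def frameForm (C : Vec n → Vec n →L[ℝ] Gl n) (u : FrameSpace n) :
    FrameSpace n →L[ℝ] Gl n :=
  (ContinuousLinearMap.mul ℝ (Gl n) (Ring.inverse u.2)).comp
    (((ContinuousLinearMap.mul ℝ (Gl n)).flip u.2).comp
        ((C u.1).comp (ContinuousLinearMap.fst ℝ (Vec n) (Gl n))) +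
      ContinuousLinearMap.snd ℝ (Vec n) (Gl n))

theorem frameForm_apply (C : Vec n → Vec n →L[ℝ] Gl n) (u W : FrameSpace n) :
    frameForm C u W = Ring.inverse u.2 * (C u.1 W.1 * u.2 + W.2) := rfl

/-- The horizontal space is a graph over the base, which forces the values chosen in
`horizontalLift` and `horizontalProj`. -/
theorem frameForm_eq_zero_iff (C : Vec n → Vec n →L[ℝ] Gl n) {u : FrameSpace n}
    (hu : IsUnit u.2) (W : FrameSpace n) :
    frameForm C u W = 0 ↔ W = (W.1, -(C u.1 W.1 * u.2)) := by
  have hinv : IsUnit (Ring.inverse u.2) := hu.ringInverse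
  rw [frameForm_apply, hinv.mul_right_eq_zero, add_eq_zero_iff_neg_eq, Prod.ext_iff]
  simp [eq_comm]

theorem horizontalLift_eq {C : Vec n → Vec n →L[ℝ] Gl n}
    {conn : FrameSpace n → FrameSpace n →L[ℝ] Gl n} {u : FrameSpace n}
    (hconn : conn u = frameForm C u) (hu : IsUnit u.2) (X : Vec n → Vec n) :
    horizontalLift conn X u = (X u.1, -(C u.1 (X u.1) * u.2)) := by
  have hmem (W : FrameSpace n) :
      W ∈ horizontalSpace conn u ↔ W = (W.1, -(C u.1 W.1 * u.2)) := by
    rw [← frameForm_eq_zero_iff C hu, ← hconn]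
    rfl
  obtain ⟨h1, h2⟩ := Classical.epsilon_spec
    (p := fun W => W ∈ horizontalSpace conn u ∧ W.1 = X u.1)
    ⟨(X u.1, -(C u.1 (X u.1) * u.2)), (hmem _).2 rfl, rfl⟩
  refine ((hmem _).1 h1).trans ?_
  rw [h2]

theorem horizontalProj_eq {C : Vec n → Vec n →L[ℝ] Gl n}
    {conn : FrameSpace n → FrameSpace n →L[ℝ] Gl n} {u : FrameSpace n}
    (hconn : conn u = frameForm C u) (hu : IsUnit u.2) (W : FrameSpace n) :
    horizontalProj conn u W = (W.1, -(C u.1 W.1 * u.2)) := by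
  have hmem (W : FrameSpace n) :
      W ∈ horizontalSpace conn u ↔ W = (W.1, -(C u.1 W.1 * u.2)) := by
    rw [← frameForm_eq_zero_iff C hu, ← hconn]
    rfl
  have hvert (W' : FrameSpace n) : W - W' ∈ verticalSpace n ↔ W'.1 = W.1 := by
    simp [verticalSpace, sub_eq_zero, eq_comm]
  obtain ⟨h1, h2⟩ := Classical.epsilon_spec
    (p := fun W' => W' ∈ horizontalSpace conn u ∧ W - W' ∈ verticalSpace n)
    ⟨(W.1, -(C u.1 W.1 * u.2)), (hmem _).2 rfl, (hvert _).2 rfl⟩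
  refine ((hmem _).1 h1).trans ?_
  rw [(hvert _).1 h2]

theorem contDiffAt_inverse_snd {u : FrameSpace n} (hu : IsUnit u.2) :
    ContDiffAt ℝ ∞ (fun v : FrameSpace n => Ring.inverse v.2) u :=
  (contDiffAt_ringInverse_of_isUnit hu).comp u contDiffAt_snd

theorem contDiffAt_frameForm {C : Vec n → Vec n →L[ℝ] Gl n} {u : FrameSpace n}
    (hC : ContDiffAt ℝ ∞ C u.1) (hu : IsUnit u.2) : ContDiffAt ℝ ∞ (frameForm C) u := by
  have h1 := contDiff_mul_clm.contDiffAt.comp u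
    (contDiffAt_inverse_snd hu)
  have h2 := contDiff_mul_flip_clm.contDiffAt.comp u
    (contDiffAt_snd (n := ∞) (𝕜 := ℝ))
  exact h1.clm_comp ((h2.clm_comp ((hC.comp u contDiffAt_fst).clm_comp contDiffAt_const)).add
    contDiffAt_const)

theorem fderiv_inverse_snd {u : FrameSpace n} (hu : IsUnit u.2) (V : FrameSpace n) :
    fderiv ℝ (fun v : FrameSpace n => Ring.inverse v.2) u V =
      -(Ring.inverse u.2 * V.2 * Ring.inverse u.2) := by
  have h : HasFDerivAt (fun v : FrameSpace n => Ring.inverse v.2) _ u :=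
    (hasFDerivAt_ringInverse_of_isUnit hu).comp u hasFDerivAt_snd
  simp [h.fderiv]

theorem hasFDerivAt_apply_fst {C : Vec n → Vec n →L[ℝ] Gl n} {u : FrameSpace n}
    (hC : DifferentiableAt ℝ C u.1) (w : Vec n) :
    HasFDerivAt (fun v : FrameSpace n => C v.1 w)
      (((fderiv ℝ C u.1).flip w).comp (ContinuousLinearMap.fst ℝ (Vec n) (Gl n))) u := by
  have h : HasFDerivAt (fun t => C t w) ((fderiv ℝ C u.1).flip w) u.1 := by
    simpa using hC.hasFDerivAt.clm_apply (hasFDerivAt_const w u.1)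
  exact h.comp u hasFDerivAt_fst

theorem fderiv_frameForm_apply {C : Vec n → Vec n →L[ℝ] Gl n} {u : FrameSpace n}
    (hC : DifferentiableAt ℝ C u.1) (hu : IsUnit u.2) {W : FrameSpace n}
    (hW : frameForm C u W = 0) (V : FrameSpace n) :
    fderiv ℝ (fun v => frameForm C v W) u V =
      Ring.inverse u.2 * (fderiv ℝ C u.1 V.1 W.1 * u.2 + C u.1 W.1 * V.2) := by
  have hinv := (contDiffAt_inverse_snd hu).differentiableAt (by simp)
  have hsum : C u.1 W.1 * u.2 + W.2 = 0 :=
    hu.ringInverse.mul_right_eq_zero.1 hW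
  have h := fderiv_mul_mul_add_const_apply hinv.hasFDerivAt (hasFDerivAt_apply_fst hC W.1)
    hasFDerivAt_snd hsum V
  exact h

theorem contDiffAt_canonicalForm {u : FrameSpace n} (hu : IsUnit u.2) :
    ContDiffAt ℝ ∞ (canonicalForm : FrameSpace n → FrameSpace n →L[ℝ] Vec n) u :=
  (contDiffAt_inverse_snd hu).clm_comp contDiffAt_const

theorem fderiv_canonicalForm_apply {u : FrameSpace n} (hu : IsUnit u.2) (V W : FrameSpace n) :
    fderiv ℝ (fun v => canonicalForm v W) u V =
      -(Ring.inverse u.2 (V.2 (Ring.inverse u.2 W.1))) := by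
  have hinv := (contDiffAt_inverse_snd hu).differentiableAt (by simp)
  change fderiv ℝ (fun v : FrameSpace n => Ring.inverse v.2 W.1) u V = _
  rw [fderiv_clm_apply hinv (differentiableAt_const _)]
  simp [fderiv_inverse_snd hu]

theorem frame_apply_inverse {a : Gl n} (ha : IsUnit a) (v : Vec n) :
    a (Ring.inverse a v) = v :=
  congrArg (fun f : Gl n => f v) (Ring.mul_inverse_cancel a ha)

/-- In the derivative of `a⁻¹`, the vertical component `-C(V)a` turns into `a⁻¹ C(V)`. Agreement of
`conn` with `frameForm C` at the single point `u` suffices: `conn` enters only through the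
projection and is not differentiated. -/
theorem torsionForm_horizontal {C : Vec n → Vec n →L[ℝ] Gl n}
    {conn : FrameSpace n → FrameSpace n →L[ℝ] Gl n} {u : FrameSpace n}
    (hconn : conn u = frameForm C u) (hu : IsUnit u.2) (V W : FrameSpace n) :
    u.2 (torsionForm conn u V W) = C u.1 V.1 W.1 - C u.1 W.1 V.1 := by
  unfold torsionForm
  rw [extDerivOne_apply ((contDiffAt_canonicalForm hu).differentiableAt (by simp)),
    horizontalProj_eq hconn hu, horizontalProj_eq hconn hu, fderiv_canonicalForm_apply hu,
    fderiv_canonicalForm_apply hu, map_sub, map_neg, map_neg, frame_apply_inverse hu,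
    frame_apply_inverse hu]
  simp [frame_apply_inverse hu]

/-- The structure equation `dC + C ∧ C`: the quadratic term arises from the vertical component
`-C(V)a` of the direction of differentiation. Here `conn` is itself differentiated, so agreement
near `u` is required. -/
theorem curvatureForm_horizontal {C : Vec n → Vec n →L[ℝ] Gl n}
    {conn : FrameSpace n → FrameSpace n →L[ℝ] Gl n} {u : FrameSpace n}
    (hconn : conn =ᶠ[nhds u] frameForm C) (hC : ContDiffAt ℝ ∞ C u.1) (hu : IsUnit u.2)
    (V W : FrameSpace n) (z : Vec n) :
    u.2 (curvatureForm conn u V W (Ring.inverse u.2 z)) =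
      fderiv ℝ C u.1 V.1 W.1 z - fderiv ℝ C u.1 W.1 V.1 z +
        C u.1 V.1 (C u.1 W.1 z) - C u.1 W.1 (C u.1 V.1 z) := by
  have hcu := hconn.eq_of_nhds
  have hC' := hC.differentiableAt (by simp)
  have hzero (a : Vec n) : frameForm C u (a, -(C u.1 a * u.2)) = 0 :=
    (frameForm_eq_zero_iff C hu _).2 rfl
  have heq (W : FrameSpace n) : fderiv ℝ (fun v => conn v W) u = fderiv ℝ
      (fun v => frameForm C v W) u :=
    Filter.EventuallyEq.fderiv_eq (hconn.mono fun v hv => by simp only [hv])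
  unfold curvatureForm
  rw [extDerivOne_apply (((contDiffAt_frameForm hC hu).differentiableAt
      (by simp)).congr_of_eventuallyEq hconn), horizontalProj_eq hcu hu, horizontalProj_eq hcu hu,
    heq, heq, fderiv_frameForm_apply hC' hu (hzero _), fderiv_frameForm_apply hC' hu (hzero _),
    ← mul_sub, mul_apply_eq_comp, frame_apply_inverse hu]
  simp [frame_apply_inverse hu]
  abel

theorem frame_fderiv_canonicalForm_horizontalLift {C : Vec n → Vec n →L[ℝ] Gl n}
    {conn : FrameSpace n → FrameSpace n →L[ℝ] Gl n} {u : FrameSpace n}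
    (hconn : ∀ᶠ v in nhds u, conn v = frameForm C v ∧ IsUnit v.2)
    {Y : Vec n → Vec n} (hY : DifferentiableAt ℝ Y u.1) (X : Vec n → Vec n) :
    u.2 (fderiv ℝ (fun v => canonicalForm v (horizontalLift conn Y v)) u
      (horizontalLift conn X u)) = fderiv ℝ Y u.1 (X u.1) + C u.1 (X u.1) (Y u.1) := by
  obtain ⟨hcu, hu⟩ := hconn.self_of_nhds
  have hinv := (contDiffAt_inverse_snd hu).differentiableAt (by simp)
  -- On a lift, `θ` sees only the base component, so the function is `a⁻¹ Y`; the connection enters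
  -- only through the direction of differentiation.
  have heq : (fun v => canonicalForm v (horizontalLift conn Y v)) =ᶠ[nhds u]
      fun v => Ring.inverse v.2 (Y v.1) :=
    hconn.mono fun v hv => by
      simp only [horizontalLift_eq hv.1 hv.2]
      rfl
  have hYu : HasFDerivAt (fun v : FrameSpace n => Y v.1) _ u :=
    hY.hasFDerivAt.comp u hasFDerivAt_fst
  rw [heq.fderiv_eq, fderiv_clm_apply hinv hYu.differentiableAt, hYu.fderiv,
    horizontalLift_eq hcu hu]
  simp [fderiv_inverse_snd hu, frame_apply_inverse hu]

end
/-! ### Charts and the local connection forms -/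

namespace OpenPartialHomeomorph

variable {n : ℕ} {x : OpenPartialHomeomorph (Vec n) (Vec n)} {t : Vec n}

theorem fderiv_symm_mul_fderiv (hx : DifferentiableAt ℝ x t)
    (hx' : DifferentiableAt ℝ x.symm (x t)) (ht : t ∈ x.source) :
    (fderiv ℝ x.symm (x t) * fderiv ℝ x t : Gl n) = 1 := by
  have h := hx'.hasFDerivAt.comp t hx.hasFDerivAt
  have h' := (hasFDerivAt_id (𝕜 := ℝ) t).congr_of_eventuallyEq (x.eventually_left_inverse ht)
  exact h.unique h'

theorem fderiv_mul_fderiv_symm (hx : DifferentiableAt ℝ x t)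
    (hx' : DifferentiableAt ℝ x.symm (x t)) (ht : t ∈ x.source) :
    (fderiv ℝ x t * fderiv ℝ x.symm (x t) : Gl n) = 1 := by
  have hx2 : HasFDerivAt x (fderiv ℝ x t) (x.symm (x t)) := by
    rw [x.left_inv ht]
    exact hx.hasFDerivAt
  have h := hx2.comp (x t) hx'.hasFDerivAt
  have h' := (hasFDerivAt_id (𝕜 := ℝ) (x t)).congr_of_eventuallyEq
    (x.eventually_right_inverse (x.map_source ht))
  exact h.unique h'

theorem contDiffAt_chartField (hx : ContDiffOn ℝ ∞ x x.source)
    (hx' : ContDiffOn ℝ ∞ x.symm x.target) (ht : t ∈ x.source) (i : Fin n) :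
    ContDiffAt ℝ ∞ (chartField x i) t := by
  have h := (hx'.contDiffAt (x.open_target.mem_nhds (x.map_source ht))).fderiv_right
    (m := ∞) (by simp)
  exact (h.comp t (hx.contDiffAt (x.open_source.mem_nhds ht))).clm_apply contDiffAt_const

/-- Differentiate the identity that `Dx` sends `e_i` to a constant vector. This is the source of the
Hessian term in the Christoffel symbols. -/
theorem fderiv_fderiv_chartField (hx : ContDiffOn ℝ ∞ x x.source)
    (hx' : ContDiffOn ℝ ∞ x.symm x.target) (ht : t ∈ x.source) (i : Fin n) (w : Vec n) :
    fderiv ℝ x t (fderiv ℝ (chartField x i) t w) =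
      -fderiv ℝ (fderiv ℝ x) t w (chartField x i t) := by
  have hconst : (fun s => fderiv ℝ x s (chartField x i s)) =ᶠ[nhds t]
      fun _ => Pi.single i 1 := by
    filter_upwards [x.open_source.mem_nhds ht] with s hs
    exact congrArg (fun f : Gl n => f (Pi.single i 1)) (fderiv_mul_fderiv_symm
      ((hx.contDiffAt (x.open_source.mem_nhds hs)).differentiableAt (by simp))
      ((hx'.contDiffAt (x.open_target.mem_nhds (x.map_source hs))).differentiableAt (by simp)) hs)
  have h := hconst.fderiv_eq (𝕜 := ℝ)
  rw [fderiv_clm_apply (hx.contDiffAt (x.open_source.mem_nhds ht)).differentiableAt_fderiv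
    ((contDiffAt_chartField hx hx' ht i).differentiableAt (by simp))] at h
  have h' := congrArg (fun f : Gl n => f w) h
  exact eq_neg_of_add_eq_zero_left (by simpa using h')

end OpenPartialHomeomorph

theorem Ring.inverse_eq_of_mul_eq_one {R : Type*} [Ring R] {a b : R} (h : a * b = 1)
    (h' : b * a = 1) : Ring.inverse a = b :=
  Ring.inverse_unit ⟨a, b, h, h'⟩

namespace StatisticalManifold

variable {n : ℕ} {𝒳 : Type*} [MeasurableSpace 𝒳] (S : StatisticalManifold n 𝒳)
  {x : OpenPartialHomeomorph (Vec n) (Vec n)} {t : Vec n}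

/-- The arguments appear as `j`, `i` because `ω_j^k = Γ_{ji}^k dx^i` places the form's direction in
the second lower index. Symmetry of the difference tensor and of `D²x` allows the swap, so `ω` is
the usual connection form. -/
theorem christoffel_eq (α : ℝ) (hS : x.source ⊆ S.Θ) (hx : ContDiffOn ℝ ∞ x x.source)
    (hx' : ContDiffOn ℝ ∞ x.symm x.target) (ht : t ∈ x.source) (i j k : Fin n) :
    S.christoffel α x i j k t =
      (fderiv ℝ x t (S.difference α t (chartField x j t) (chartField x i t)) -
        fderiv ℝ (fderiv ℝ x) t (chartField x j t) (chartField x i t)) k := by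
  have hsymm := (hx.contDiffAt (x.open_source.mem_nhds ht)).isSymmSndFDerivAt_of_smooth
  unfold christoffel
  rw [S.nabla_eq α (hS ht) _ _
    ((OpenPartialHomeomorph.contDiffAt_chartField hx hx' ht j).differentiableAt (by simp)),
    S.difference_symm α (hS ht), hsymm.eq (chartField x j t)]
  change fderiv ℝ x t _ k = _
  rw [map_add, OpenPartialHomeomorph.fderiv_fderiv_chartField hx hx' ht, neg_add_eq_sub]

theorem alphaForm_apply (α : ℝ) (hS : x.source ⊆ S.Θ) (hx : ContDiffOn ℝ ∞ x x.source)
    (hx' : ContDiffOn ℝ ∞ x.symm x.target) (ht : t ∈ x.source) (a v : Vec n) :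
    S.alphaForm α x t a v =
      fderiv ℝ x t (S.difference α t a (fderiv ℝ x.symm (x t) v)) -
        fderiv ℝ (fderiv ℝ x) t a (fderiv ℝ x.symm (x t) v) := by
  have hxt := (hx.contDiffAt (x.open_source.mem_nhds ht)).differentiableAt (by simp)
  have hxt' := (hx'.contDiffAt (x.open_target.mem_nhds (x.map_source ht))).differentiableAt
    (by simp)
  let B : Vec n →L[ℝ] Gl n := (ContinuousLinearMap.mul ℝ (Gl n) (fderiv ℝ x t)).comp
    (S.difference α t) - fderiv ℝ (fderiv ℝ x) t
  let Ψ : Gl n := fderiv ℝ x.symm (x t)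
  -- Both sides are bilinear in `a` and `v`: `a` is expanded in the chart frame with coefficients
  -- `dx^i(a)`, and `v` in the standard basis, so that only pairs of frame vectors remain.
  have ha : a = ∑ i, fderiv ℝ x t a i • Ψ (Pi.single i 1) := by
    rw [← ContinuousLinearMap.apply_eq_sum_single]
    exact (congrArg (fun f : Gl n => f a) (x.fderiv_symm_mul_fderiv hxt hxt' ht)).symm
  have hB : S.alphaForm α x t a v = B a (Ψ v) := by
    conv_rhs => rw [ha, ContinuousLinearMap.apply_eq_sum_single Ψ v]
    ext k
    simp only [map_sum, map_smul, sum_apply, smul_apply, Finset.sum_apply, Pi.smul_apply]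
    simp only [alphaForm, sum_apply, ContinuousLinearMap.smulRight_apply, smul_apply,
      Finset.sum_apply, Pi.smul_apply]
    simp only [Finset.smul_sum]
    simp only [matrixToGl, LinearMap.coe_toContinuousLinearMap', Matrix.toLin'_apply,
      Matrix.mulVec, dotProduct, Matrix.of_apply, smul_eq_mul, Finset.mul_sum]
    rw [Finset.sum_comm]
    refine Finset.sum_congr rfl fun j _ => Finset.sum_congr rfl fun i _ => ?_
    rw [S.christoffel_eq α hS hx hx' ht]
    change fderiv ℝ x t a i * (B (Ψ (Pi.single i 1)) (Ψ (Pi.single j 1)) k * v j) = _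
    ring
  exact hB

theorem fderiv_trivialization (hx : ContDiffAt ℝ ∞ x t) (a : Gl n) (W : FrameSpace n) :
    fderiv ℝ (trivialization x) (t, a) W = fderiv ℝ (fderiv ℝ x) t W.1 * a +
      fderiv ℝ x t * W.2 := by
  have h1 : HasFDerivAt (fun v : FrameSpace n => fderiv ℝ x v.1)
      ((fderiv ℝ (fderiv ℝ x) t).comp (ContinuousLinearMap.fst ℝ (Vec n) (Gl n))) (t, a) :=
    HasFDerivAt.comp (t, a) hx.differentiableAt_fderiv.hasFDerivAt hasFDerivAt_fst
  have h2 : HasFDerivAt (fun v : FrameSpace n => v.2)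
      (ContinuousLinearMap.snd ℝ (Vec n) (Gl n)) (t, a) := hasFDerivAt_snd
  have h : HasFDerivAt (trivialization x) _ (t, a) := h1.clm_comp h2
  rw [h.fderiv]
  ext v
  simp [add_comm]

/-- The `D²x` term of `φ⁻¹dφ` cancels the one in `alphaForm`. Agreement on overlaps follows because
the right-hand side is independent of the chart. -/
theorem localAlphaForm_eq (α : ℝ) (hS : x.source ⊆ S.Θ) (hx : ContDiffOn ℝ ∞ x x.source)
    (hx' : ContDiffOn ℝ ∞ x.symm x.target) {u : FrameSpace n} (hu : u.1 ∈ x.source)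
    (hu' : IsUnit u.2) :
    S.localAlphaForm α x u = frameForm (S.difference α) u := by
  obtain ⟨t, a⟩ := u
  simp only at hu hu'
  have hxt := hx.contDiffAt (x.open_source.mem_nhds hu)
  have hxd := hxt.differentiableAt (by simp)
  have hxd' := (hx'.contDiffAt (x.open_target.mem_nhds (x.map_source hu))).differentiableAt
    (by simp)
  have h1 := x.fderiv_symm_mul_fderiv hxd hxd' hu
  have h2 := x.fderiv_mul_fderiv_symm hxd hxd' hu
  have hinv : Ring.inverse (trivialization x (t, a)) =
      Ring.inverse a * fderiv ℝ x.symm (x t) := by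
    refine Ring.inverse_eq_of_mul_eq_one ?_ ?_
    · change fderiv ℝ x t * a * (Ring.inverse a * fderiv ℝ x.symm (x t)) = 1
      rw [mul_assoc, ← mul_assoc a, Ring.mul_inverse_cancel a hu', one_mul, h2]
    · change Ring.inverse a * fderiv ℝ x.symm (x t) * (fderiv ℝ x t * a) = 1
      rw [mul_assoc, ← mul_assoc _ _ a, h1, one_mul, Ring.inverse_mul_cancel a hu']
  have hcancel (v : Vec n) : fderiv ℝ x.symm (x t) (fderiv ℝ x t v) = v :=
    congrArg (fun f : Gl n => f v) h1
  refine ContinuousLinearMap.ext fun W => ContinuousLinearMap.ext fun v => ?_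
  have hL : S.localAlphaForm α x (t, a) W =
      Ring.inverse (trivialization x (t, a)) * S.alphaForm α x t W.1 * (fderiv ℝ x t * a) +
        Ring.inverse (trivialization x (t, a)) * fderiv ℝ (trivialization x) (t, a) W := rfl
  rw [hL, hinv, fderiv_trivialization hxt, frameForm_apply]
  change Ring.inverse a (fderiv ℝ x.symm (x t) (S.alphaForm α x t W.1 (fderiv ℝ x t (a v)))) +
    Ring.inverse a (fderiv ℝ x.symm (x t) (fderiv ℝ (fderiv ℝ x) t W.1 (a v) +
      fderiv ℝ x t (W.2 v))) = Ring.inverse a (S.difference α t W.1 (a v) + W.2 v)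
  rw [S.alphaForm_apply α hS hx hx' hu, ← map_add, ← map_add, hcancel]
  -- The two Hessian terms cancel at `sub_add_cancel`.
  rw [← add_assoc, sub_add_cancel, ← map_add, hcancel]

/-! ### The glued connection form on the frame bundle. -/

variable {J : Type*} (𝒜 : S.Atlas J)

theorem alphaConnectionForm_eq (α : ℝ) {u : FrameSpace n} (hu : u ∈ S.frameBundle) :
    S.alphaConnectionForm 𝒜 α u = frameForm (S.difference α) u := by
  have h := 𝒜.covers u.1 hu.1
  rw [alphaConnectionForm, dif_pos h]
  exact S.localAlphaForm_eq α (𝒜.source_subset _) (𝒜.smooth _) (𝒜.smooth_symm _) h.choose_spec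
    hu.2

theorem isOpen_frameBundle : IsOpen S.frameBundle :=
  (S.isOpen_Θ.preimage continuous_fst).inter (Units.isOpen.preimage continuous_snd)

theorem isConnectionForm_alphaConnectionForm (α : ℝ) :
    S.IsConnectionForm (S.alphaConnectionForm 𝒜 α) where
  smooth := by
    refine ContDiffOn.congr (fun u hu => ?_) fun u hu => S.alphaConnectionForm_eq 𝒜 α hu
    exact (contDiffAt_frameForm (S.contDiffAt_difference α hu.1) hu.2).contDiffWithinAt
  fundamental u hu A := by
    rw [S.alphaConnectionForm_eq 𝒜 α hu, frameForm_apply]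
    simp [fundamentalField, Ring.inverse_mul_cancel_left _ _ hu.2]
  equivariant u hu g hg W := by
    have hug : rightTranslation g u ∈ S.frameBundle := ⟨hu.1, hu.2.mul hg⟩
    rw [S.alphaConnectionForm_eq 𝒜 α hu, S.alphaConnectionForm_eq 𝒜 α hug, frameForm_apply,
      frameForm_apply]
    have hinv : Ring.inverse (u.2 * g) = Ring.inverse g * Ring.inverse u.2 := by
      obtain ⟨a, ha⟩ := hu.2
      obtain ⟨b, rfl⟩ := hg
      rw [← ha, ← Units.val_mul, Ring.inverse_unit, Ring.inverse_unit, Ring.inverse_unit,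
        mul_inv_rev, Units.val_mul]
    simp only [rightTranslation, adInv, hinv, ContinuousLinearMap.mulLeftRight_apply]
    noncomm_ring

/-! ### Iterated covariant derivatives and the curvature on the base. -/

theorem fderiv_nabla (α : ℝ) (ht : t ∈ S.Θ) {Y Z : Vec n → Vec n} (hY : S.IsSmoothField Y)
    (hZ : S.IsSmoothField Z) (w : Vec n) :
    DifferentiableAt ℝ (S.nabla α Y Z) t ∧ fderiv ℝ (S.nabla α Y Z) t w =
      fderiv ℝ (fderiv ℝ Z) t w (Y t) + fderiv ℝ Z t (fderiv ℝ Y t w) +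
        (fderiv ℝ (S.difference α) t w (Y t) (Z t) +
          S.difference α t (fderiv ℝ Y t w) (Z t) +
          S.difference α t (Y t) (fderiv ℝ Z t w)) := by
  have hΘ := S.isOpen_Θ.mem_nhds ht
  have hYt := (hY.contDiffAt hΘ).differentiableAt (by simp)
  have hZt := (hZ.contDiffAt hΘ).differentiableAt (by simp)
  have hZ2 := (hZ.contDiffAt hΘ).differentiableAt_fderiv
  have hC := (S.contDiffAt_difference α ht).differentiableAt (by simp)
  have heq : S.nabla α Y Z =ᶠ[nhds t]
      fun s => fderiv ℝ Z s (Y s) + S.difference α s (Y s) (Z s) := by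
    filter_upwards [hΘ] with s hs
    exact S.nabla_eq α hs Y Z
      ((hZ.contDiffAt (S.isOpen_Θ.mem_nhds hs)).differentiableAt (by simp))
  have h1 := hZ2.hasFDerivAt.clm_apply hYt.hasFDerivAt
  have h2 := (hC.hasFDerivAt.clm_apply hYt.hasFDerivAt).clm_apply hZt.hasFDerivAt
  have h := (h1.add h2).congr_of_eventuallyEq heq
  refine ⟨h.differentiableAt, ?_⟩
  rw [h.fderiv]
  simp
  abel

/-- Everything non-tensorial cancels: `D²Z` by symmetry, the cross terms `C(X)DZ(Y) + C(Y)DZ(X)` by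
antisymmetrization, and the derivatives of `X` and `Y` against `[X, Y] = DY(X) - DX(Y)`. -/
theorem curvature_nabla (α : ℝ) (ht : t ∈ S.Θ) {X Y Z : Vec n → Vec n} (hX : S.IsSmoothField X)
    (hY : S.IsSmoothField Y) (hZ : S.IsSmoothField Z) :
    S.nabla α X (S.nabla α Y Z) t - S.nabla α Y (S.nabla α X Z) t -
        S.nabla α (VectorField.lieBracket ℝ X Y) Z t =
      fderiv ℝ (S.difference α) t (X t) (Y t) (Z t) -
        fderiv ℝ (S.difference α) t (Y t) (X t) (Z t) +
        S.difference α t (X t) (S.difference α t (Y t) (Z t)) -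
        S.difference α t (Y t) (S.difference α t (X t) (Z t)) := by
  have hΘ := S.isOpen_Θ.mem_nhds ht
  have hZt := (hZ.contDiffAt hΘ).differentiableAt (by simp)
  have hsymm := ((hZ.contDiffAt hΘ).isSymmSndFDerivAt_of_smooth).eq (X t) (Y t)
  obtain ⟨hYZ, hYZ'⟩ := S.fderiv_nabla α ht hY hZ (X t)
  obtain ⟨hXZ, hXZ'⟩ := S.fderiv_nabla α ht hX hZ (Y t)
  rw [S.nabla_eq α ht _ _ hYZ, S.nabla_eq α ht _ _ hXZ, S.nabla_eq α ht _ Z hZt, hYZ', hXZ',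
    S.nabla_eq α ht _ Z hZt, S.nabla_eq α ht _ Z hZt, hsymm, VectorField.lieBracket_eq]
  simp only [map_add, map_sub, sub_apply]
  abel

end StatisticalManifold

theorem theorem5p8 {n : ℕ} {𝒳 : Type*} [MeasurableSpace 𝒳] (S : StatisticalManifold n 𝒳)
    {J : Type*} (𝒜 : S.Atlas J) (α : ℝ) :
    -- the local forms glue to a connection form on the frame bundle
    (∀ β : J, ∀ u ∈ S.frameBundle, u.1 ∈ (𝒜.chart β).source →
      S.alphaConnectionForm 𝒜 α u = S.localAlphaForm α (𝒜.chart β) u) ∧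
    S.IsConnectionForm (S.alphaConnectionForm 𝒜 α) ∧
    ∀ X Y Z : Vec n → Vec n, S.IsSmoothField X → S.IsSmoothField Y → S.IsSmoothField Z →
      ∀ u ∈ S.frameBundle,
        S.nabla α X Y u.1 =
          u.2 (fderiv ℝ
            (fun v => canonicalForm v (horizontalLift (S.alphaConnectionForm 𝒜 α) Y v)) u
            (horizontalLift (S.alphaConnectionForm 𝒜 α) X u)) ∧
        u.2 (torsionForm (S.alphaConnectionForm 𝒜 α) u
            (horizontalLift (S.alphaConnectionForm 𝒜 α) X u)
            (horizontalLift (S.alphaConnectionForm 𝒜 α) Y u)) =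
          S.nabla α X Y u.1 - S.nabla α Y X u.1 - VectorField.lieBracket ℝ X Y u.1 ∧
        u.2 (curvatureForm (S.alphaConnectionForm 𝒜 α) u
            (horizontalLift (S.alphaConnectionForm 𝒜 α) X u)
            (horizontalLift (S.alphaConnectionForm 𝒜 α) Y u) (Ring.inverse u.2 (Z u.1))) =
          S.nabla α X (S.nabla α Y Z) u.1 - S.nabla α Y (S.nabla α X Z) u.1 -
            S.nabla α (VectorField.lieBracket ℝ X Y) Z u.1 := by

  refine ⟨fun β u hu hβ => ?_, S.isConnectionForm_alphaConnectionForm 𝒜 α,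
    fun X Y Z hX hY hZ u hu => ?_⟩
  · rw [S.alphaConnectionForm_eq 𝒜 α hu,
      S.localAlphaForm_eq α (𝒜.source_subset β) (𝒜.smooth β) (𝒜.smooth_symm β) hβ hu.2]
  have hΘ := S.isOpen_Θ.mem_nhds hu.1
  have hXu := (hX.contDiffAt hΘ).differentiableAt (by simp)
  have hYu := (hY.contDiffAt hΘ).differentiableAt (by simp)
  have hcu := S.alphaConnectionForm_eq 𝒜 α hu
  -- The explicit formula must hold on a neighbourhood, since the covariant derivative and curvature
  -- identities differentiate expressions built from the form.
  have hconn : ∀ᶠ v in nhds u, S.alphaConnectionForm 𝒜 α v = frameForm (S.difference α) v ∧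
      IsUnit v.2 := by
    filter_upwards [S.isOpen_frameBundle.mem_nhds hu] with v hv
    exact ⟨S.alphaConnectionForm_eq 𝒜 α hv, hv.2⟩
  refine ⟨?_, ?_, ?_⟩
  · rw [frame_fderiv_canonicalForm_horizontalLift hconn hYu, S.nabla_eq α hu.1 X Y hYu]
  · rw [torsionForm_horizontal hcu hu.2, S.nabla_eq α hu.1 X Y hYu, S.nabla_eq α hu.1 Y X hXu,
      horizontalLift_eq hcu hu.2, horizontalLift_eq hcu hu.2, VectorField.lieBracket_eq]
    beta_reduce
    abel
  · rw [curvatureForm_horizontal (hconn.mono fun v hv => hv.1) (S.contDiffAt_difference α hu.1)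
      hu.2, S.curvature_nabla α hu.1 hX hY hZ, horizontalLift_eq hcu hu.2,
      horizontalLift_eq hcu hu.2]
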